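/- Let $T$ be a finite tree with $n\ge 1$ vertices and let $m\ge 0$, $t\ge 0$ be integers. The $m$-order subdivision of a graph is obtained by inserting $m$ new vertices into each edge, i.e. by replacing every edge $uv$ by a path $u\,w_1\cdots w_m\,v$ of length $m+1$ with new inner vertices. Let $T^m(0)=T$, let $T^m(s+1)$ be the $m$-order subdivision of $T^m(s)$, and write $|T^m(s)|$ for the number of vertices of $T^m(s)$. Let $W_T=\frac12\sum_{u,v\in T}d_{uv}$ be the Wiener index of $T$, where $d_{uv}$ is the graph distance. For a finite connected graph $G$ with vertex set $V$, $|V|\ge 2$, let $H_{u\to v}$ be the expected first time at which the simple random walk on $G$ started at $u$ (each step is to a uniformly chosen neighbour) is at $v$, so that $H_{u\to u}=0$, and let $$\langle H_G\rangle=\frac{1}{|V|(|V|-1)}\sum_{u,v\in V}H_{u\to v}$$ be the mean hitting time. Then $$|T^m(t)|=(n-1)(m+1)^t+1,$$ and, if $n\ge 2$, the mean hitting time of $T^m(t)$ is finite and equals $$\langle H_{T^m(t)}\rangle=\frac{2}{|T^m(t)|}\Big\{f_1^{\,t}\,W_T-g_1\sum_{i=0}^{t-1}f_1^{\,i}\,|T^m(t-1-i)|^2+h_1\sum_{i=0}^{t-1}f_1^{\,i}\,|T^m(t-1-i)|-l_1\sum_{i=0}^{t-1}f_1^{\,i}\Big\},$$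 where $f_1=(m+1)^3$, $g_1=\frac{m(m+1)^2}{2}$, $h_1=\frac{m(m+1)(2m+1)}{3}$ and $l_1=\frac{m(m^2-1)}{6}$. -/

import Mathlib

open MeasureTheory ProbabilityTheory
open scoped ENNReal

noncomputable section

namespace SubdivisionTree

universe u

/-! ### Wiener index -/

/-- Wiener index: half the sum of the distances over all ordered pairs of vertices. -/
def wienerIndex {V : Type u} [Fintype V] (G : SimpleGraph V) : ℝ :=
  (1 / 2) * ∑ x : V, ∑ y : V, (G.dist x y : ℝ)

/-! ### Simple random walk and hitting times -/

open Classical in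
/-- Law of one step of the simple random walk from `x`: uniform on the neighbours of `x`.
(At an isolated vertex, which a connected graph with two or more vertices does not have, the
walk stays put.) -/
def stepLaw {V : Type u} [Fintype V] (G : SimpleGraph V) (x : V) : PMF V :=
  if h : (G.neighborFinset x).Nonempty then PMF.uniformOfFinset (G.neighborFinset x) h
  else PMF.pure x

/-- The transition kernel of the simple random walk, as a function of the history up to time `k`:
only the position at time `k` matters. -/
def stepKernel {V : Type u} [Fintype V] [MeasurableSpace V] [DiscreteMeasurableSpace V]
    (G : SimpleGraph V) (k : ℕ) : Kernel ((i : Finset.Iic k) → (fun _ : ℕ => V) i) V where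
  toFun past := (stepLaw G (past ⟨k, Finset.mem_Iic.2 le_rfl⟩)).toMeasure
  measurable' :=
    (Measurable.of_discrete (f := fun x : V => (stepLaw G x).toMeasure)).comp
      (measurable_pi_apply _)

instance {V : Type u} [Fintype V] [MeasurableSpace V] [DiscreteMeasurableSpace V]
    (G : SimpleGraph V) (k : ℕ) : IsMarkovKernel (stepKernel G k) :=
  ⟨fun past =>
    PMF.toMeasure.isProbabilityMeasure (stepLaw G (past ⟨k, Finset.mem_Iic.2 le_rfl⟩))⟩

/-- Law on trajectories `ℕ → V` of the simple random walk on `G` started at `x`. -/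
def walkLaw {V : Type u} [Fintype V] [MeasurableSpace V] [DiscreteMeasurableSpace V]
    (G : SimpleGraph V) (x : V) : Measure (ℕ → V) :=
  Kernel.traj (X := fun _ : ℕ => V) (stepKernel G) 0 (fun _ => x)

/-- The first time at which the trajectory `ω` is at `y` (`∞` if it never is). -/
def firstHit {V : Type u} (y : V) (ω : ℕ → V) : ℝ≥0∞ :=
  ⨅ (k : ℕ) (_ : ω k = y), (k : ℝ≥0∞)

/-- Hitting time from `x` to `y`: the expectation of the first time at which the simple random
walk started at `x` is at `y`. -/
def hittingTime {V : Type u} [Fintype V] (G : SimpleGraph V) (x y : V) : ℝ≥0∞ :=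
  letI : MeasurableSpace V := ⊤
  haveI : DiscreteMeasurableSpace V := ⟨fun _ => trivial⟩
  ∫⁻ ω, firstHit y ω ∂(walkLaw G x)

/-- Mean hitting time: the average of the hitting times over all ordered pairs of distinct
vertices (the pairs `(x, x)` contribute `0`). -/
def meanHittingTime {V : Type u} [Fintype V] (G : SimpleGraph V) : ℝ≥0∞ :=
  (∑ x : V, ∑ y : V, hittingTime G x y) /
    ((Fintype.card V : ℝ≥0∞) * ((Fintype.card V : ℝ≥0∞) - 1))

/-! ### Subdivision -/

/-- Vertices of the `m`-order subdivision: the old vertices, and `m` new ones for each edge. -/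
abbrev SubdivVertex {V : Type u} (m : ℕ) (G : SimpleGraph V) : Type u :=
  V ⊕ (G.edgeSet × Fin m)

/-- The `k`-th vertex of the path `u, w₁, …, wₘ, v` that replaces the edge `e = uv`, for
`0 ≤ k ≤ m + 1`. The order in which the two endpoints `u, v` are taken is chosen arbitrarily for
each edge. -/
def edgePath {V : Type u} (m : ℕ) (G : SimpleGraph V) (e : G.edgeSet) (k : ℕ) :
    SubdivVertex m G :=
  if k = 0 then Sum.inl (Quot.out (e : Sym2 V)).1
  else if h : k - 1 < m then Sum.inr (e, ⟨k - 1, h⟩)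
  else Sum.inl (Quot.out (e : Sym2 V)).2

/-- The `m`-order subdivision of `G`: every edge is replaced by a path of length `m + 1` through
`m` new vertices. -/
def subdivision {V : Type u} (m : ℕ) (G : SimpleGraph V) : SimpleGraph (SubdivVertex m G) :=
  SimpleGraph.fromEdgeSet
    {s | ∃ e : G.edgeSet, ∃ k : ℕ, k ≤ m ∧ s = s(edgePath m G e k, edgePath m G e (k + 1))}

/-- The result of applying the `m`-order subdivision `t` times to the seed `G`, as a vertex type
together with a graph on it. -/
def iterSubdivision {V : Type u} (m : ℕ) (G : SimpleGraph V) : ℕ → Σ W : Type u, SimpleGraph W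
  | 0 => ⟨V, G⟩
  | t + 1 => ⟨SubdivVertex m (iterSubdivision m G t).2, subdivision m (iterSubdivision m G t).2⟩

/-- The vertex set of the subdivision graph after `t` steps. -/
abbrev Vert {V : Type u} (m : ℕ) (G : SimpleGraph V) (t : ℕ) : Type u :=
  (iterSubdivision m G t).1

/-- The subdivision graph after `t` steps. -/
abbrev graph {V : Type u} (m : ℕ) (G : SimpleGraph V) (t : ℕ) : SimpleGraph (Vert m G t) :=
  (iterSubdivision m G t).2

theorem finite_vert {V : Type u} [Finite V] (m : ℕ) (G : SimpleGraph V) (t : ℕ) :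
    Finite (Vert m G t) := by
  induction t with
  | zero => exact inferInstanceAs (Finite V)
  | succ t ih =>
    exact inferInstanceAs (Finite (Vert m G t ⊕ ((graph m G t).edgeSet × Fin m)))

instance {V : Type u} [Fintype V] (m : ℕ) (G : SimpleGraph V) (t : ℕ) : Fintype (Vert m G t) :=
  haveI := finite_vert m G t
  Fintype.ofFinite _

/-! ### Coefficients -/

def f₁ (m : ℕ) : ℝ := ((m : ℝ) + 1) ^ 3

def g₁ (m : ℕ) : ℝ := (m : ℝ) * ((m : ℝ) + 1) ^ 2 / 2

def h₁ (m : ℕ) : ℝ := (m : ℝ) * ((m : ℝ) + 1) * (2 * (m : ℝ) + 1) / 3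

def l₁ (m : ℕ) : ℝ := (m : ℝ) * ((m : ℝ) ^ 2 - 1) / 6

end SubdivisionTree

end

/-! The proof reduces mean hitting times to the Wiener index, then tracks that index under one
subdivision.

In a tree, the Laplacian at `x` of the distance to `z` is `deg x - 2` for `x ≠ z` and `deg x` for `x
= z` (`sum_dist_sub_dist`). A degree-weighted combination of distances therefore solves the Poisson
equation for the hitting times of `y` (`hittingTime_of_isTree`), and any finite nonnegative solution
is the hitting time (`lintegral_firstHit`). Adding both directions gives the commute time `2(n-1)
d(x,y)`, so the mean hitting time is `2W/n` (`meanHittingTime_of_isTree`).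

The subdivision of a tree is a tree. Its distances are affine along each subdivided edge, and
bilinear for points on two different edges (`dist_edgePath_of_ne`). Summing them, with
degree-weighted distance sums expressed through `W`, gives `W' = f₁ W - g₁ n² + h₁ n - l₁`
(`wienerIndex_subdivision`). Unrolling this recursion gives the formula. -/

noncomputable section

namespace SubdivisionTree

universe u

/-! ### Hitting times from a Poisson equation -/

section RandomWalk

open Classical in
/-- Indicator of the event that the trajectory `ω` avoids `y` up to time `k`. -/
def avoids {V : Type u} (y : V) (k : ℕ) (ω : ℕ → V) : ℝ≥0∞ :=
  if ∀ i ≤ k, ω i ≠ y then 1 else 0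

open Classical in
theorem avoids_succ {V : Type u} (y : V) (k : ℕ) (ω : ℕ → V) :
    avoids y (k + 1) ω = avoids y k ω * (if ω (k + 1) = y then 0 else 1) := by
  unfold avoids
  by_cases h : ω (k + 1) = y
  · have : ¬ ∀ i ≤ k + 1, ω i ≠ y := fun H => H _ le_rfl h
    simp [h, this]
  · have : (∀ i ≤ k + 1, ω i ≠ y) ↔ ∀ i ≤ k, ω i ≠ y := by
      refine ⟨fun H i hi => H i (by omega), fun H i hi => ?_⟩
      rcases Nat.lt_or_ge i (k + 1) with h1 | h1
      · exact H i (by omega)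
      · obtain rfl : i = k + 1 := by omega
        exact h
    rw [if_neg h, mul_one]
    exact if_congr this rfl rfl

/-- Tail-sum formula: a value `N` in `ℕ ∪ {∞}` is the number of `k` with `k < N`. -/
theorem firstHit_eq_tsum_avoids {V : Type u} (y : V) (ω : ℕ → V) :
    firstHit y ω = ∑' k, avoids y k ω := by
  classical
  unfold firstHit
  by_cases h : ∃ k, ω k = y
  · have h1 : ∀ k, avoids y k ω = if k < Nat.find h then 1 else 0 := by
      intro k
      unfold avoids
      congr 1
      rw [Nat.lt_find_iff]
    have h2 : (∑' k, avoids y k ω) = (Nat.find h : ℝ≥0∞) := by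
      rw [tsum_eq_sum (s := Finset.range (Nat.find h))]
      · rw [Finset.sum_congr rfl (g := fun _ => (1 : ℝ≥0∞))]
        · simp
        · intro k hk
          rw [h1, if_pos (Finset.mem_range.1 hk)]
      · intro k hk
        rw [h1, if_neg (fun h' => hk (Finset.mem_range.2 h'))]
    rw [h2]
    refine le_antisymm (iInf₂_le (Nat.find h) (Nat.find_spec h)) (le_iInf₂ fun k hk => ?_)
    exact_mod_cast Nat.find_min' h hk
  · push Not at h
    have h1 : ∀ k, avoids y k ω = 1 := fun k => if_pos fun i _ => h i
    simp [h1, h]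

theorem measurable_avoids {V : Type u} [MeasurableSpace V] [DiscreteMeasurableSpace V] (y : V)
    (k : ℕ) : Measurable (avoids y k) := by
  classical
  refine Measurable.ite ?_ measurable_const measurable_const
  have : {ω : ℕ → V | ∀ i ≤ k, ω i ≠ y} = ⋂ i ∈ Finset.Iic k, (fun ω => ω i) ⁻¹' {y}ᶜ := by
    ext ω; simp
  rw [this]
  exact Finset.measurableSet_biInter _ fun i _ => measurable_pi_apply i (MeasurableSet.of_discrete)

variable {V : Type u} [Fintype V] [MeasurableSpace V] [DiscreteMeasurableSpace V]
  (G : SimpleGraph V)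

instance (x : V) : IsProbabilityMeasure (walkLaw G x) := by
  unfold walkLaw; infer_instance

/-- Markov property at time `k`. -/
theorem lintegral_walkLaw_succ (x : V) (k : ℕ)
    (F : ((i : Finset.Iic k) → (fun _ : ℕ => V) i) → ℝ≥0∞) (f : V → ℝ≥0∞) :
    ∫⁻ ω, F (Preorder.frestrictLe k ω) * f (ω (k + 1)) ∂(walkLaw G x) =
      ∫⁻ ω, F (Preorder.frestrictLe k ω) * ∑ z, f z * stepLaw G (ω k) z ∂(walkLaw G x) := by
  have hF : Measurable F := Measurable.of_discrete
  have hf : Measurable f := Measurable.of_discrete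
  -- The joint law of the past up to `k` and the next position is the law of the past composed with
  -- one step of the kernel.
  have key := Kernel.partialTraj_compProd_eq_map_traj (X := fun _ : ℕ => V) (κ := stepKernel G)
    (zero_le (a := k)) (x₀ := fun _ => x)
  have hmap : (Kernel.traj (X := fun _ : ℕ => V) (stepKernel G) 0 (fun _ => x)).map
      (Preorder.frestrictLe k) = Kernel.partialTraj (X := fun _ : ℕ => V) (stepKernel G) 0 k
        (fun _ => x) := by
    rw [← Kernel.traj_map_frestrictLe, Kernel.map_apply _ (by fun_prop)]
  unfold walkLaw
  have e1 : ∫⁻ ω, F (Preorder.frestrictLe k ω) * f (ω (k + 1))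
        ∂(Kernel.traj (X := fun _ : ℕ => V) (stepKernel G) 0 (fun _ => x)) =
      ∫⁻ p, F p.1 * f p.2 ∂((Kernel.traj (X := fun _ : ℕ => V) (stepKernel G) 0 (fun _ => x)).map
        (fun ω => (Preorder.frestrictLe k ω, ω (k + 1)))) := by
    rw [lintegral_map (by fun_prop) (by fun_prop)]
  rw [e1, ← key, Measure.lintegral_compProd (by fun_prop), ← hmap,
    lintegral_map (by fun_prop) (by fun_prop)]
  refine lintegral_congr fun ω => ?_
  refine (lintegral_const_mul (F (Preorder.frestrictLe k ω)) hf).trans ?_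
  congr 1
  change ∫⁻ z, f z ∂(stepLaw G (ω k)).toMeasure = _
  rw [lintegral_fintype]
  refine Finset.sum_congr rfl fun z _ => ?_
  rw [PMF.toMeasure_apply_singleton _ _ (MeasurableSet.of_discrete)]

theorem walkLaw_zero (x : V) : ∀ᵐ ω ∂(walkLaw G x), ω 0 = x := by
  have hmap : (Kernel.traj (X := fun _ : ℕ => V) (stepKernel G) 0 (fun _ => x)).map
      (Preorder.frestrictLe 0) = Measure.dirac (fun _ => x) := by
    rw [← Kernel.map_apply _ (by fun_prop), Kernel.traj_map_frestrictLe, Kernel.partialTraj_self,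
      Kernel.id_apply]
  have h : ∀ᵐ p ∂((Kernel.traj (X := fun _ : ℕ => V) (stepKernel G) 0 (fun _ => x)).map
      (Preorder.frestrictLe 0)), p ⟨0, Finset.mem_Iic.2 le_rfl⟩ = x := by
    rw [hmap, ae_dirac_iff (MeasurableSet.of_discrete)]
  exact ae_of_ae_map (by fun_prop) h

/-- As `h y = 0`, the condition of avoiding `y` at time `k + 1` is automatic in the integrand. The
remaining weight depends only on the past up to `k`, so the Markov property applies. -/
theorem lintegral_avoids_succ (x y : V) (k : ℕ) (h : V → ℝ≥0∞) (hy : h y = 0) :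
    ∫⁻ ω, avoids y (k + 1) ω * h (ω (k + 1)) ∂(walkLaw G x) =
      ∫⁻ ω, avoids y k ω * ∑ z, h z * stepLaw G (ω k) z ∂(walkLaw G x) := by
  classical
  let F : ((i : Finset.Iic k) → (fun _ : ℕ => V) i) → ℝ≥0∞ :=
    fun p => if ∀ i, p i ≠ y then 1 else 0
  have hF : ∀ ω : ℕ → V, avoids y k ω = F (Preorder.frestrictLe k ω) := by
    intro ω
    refine if_congr ?_ rfl rfl
    exact ⟨fun H i => H i (Finset.mem_Iic.1 i.2), fun H i hi => H ⟨i, Finset.mem_Iic.2 hi⟩⟩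
  have e : ∀ ω : ℕ → V, avoids y (k + 1) ω * h (ω (k + 1)) =
      F (Preorder.frestrictLe k ω) * h (ω (k + 1)) := by
    intro ω
    rw [avoids_succ, hF, mul_assoc]
    by_cases h' : ω (k + 1) = y
    · simp [h', hy]
    · simp [h']
  simp_rw [e, hF]
  exact lintegral_walkLaw_succ G x k F h

/-- Iterating the Poisson equation along the stopped walk gives `h x = ∑_{j<K} P(no hit up to j) +
remainder`. The partial sums are bounded by `h x < ∞`, so the non-hitting probabilities tend to `0`.
This kills the remainder because `h` is bounded; recurrence need not be known beforehand. -/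
theorem lintegral_firstHit (y : V) (h : V → ℝ≥0∞) (hfin : ∀ x, h x ≠ ⊤) (hy : h y = 0)
    (hstep : ∀ x, x ≠ y → h x = 1 + ∑ z, h z * stepLaw G x z) (x : V) :
    ∫⁻ ω, firstHit y ω ∂(walkLaw G x) = h x := by
  classical
  have hmeas : Measurable h := Measurable.of_discrete
  have hmeasQ : Measurable (fun w => ∑ z, h z * stepLaw G w z) := Measurable.of_discrete
  have hma := measurable_avoids (V := V) y
  set a : ℕ → ℝ≥0∞ := fun k => ∫⁻ ω, avoids y k ω ∂(walkLaw G x)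
  set b : ℕ → ℝ≥0∞ := fun k => ∫⁻ ω, avoids y k ω * h (ω k) ∂(walkLaw G x)
  have hb0 : b 0 = h x := by
    have : ∀ᵐ ω ∂(walkLaw G x), avoids y 0 ω * h (ω 0) = h x := by
      filter_upwards [walkLaw_zero G x] with ω hω
      by_cases hxy : x = y
      · simp [hω, hxy, hy]
      · have : avoids y 0 ω = 1 := if_pos fun i hi => by
          obtain rfl : i = 0 := by omega
          rwa [hω]
        rw [this, one_mul, hω]
    simp only [b]
    rw [lintegral_congr_ae this]
    simp
  have hrec : ∀ k, b k = a k + b (k + 1) := by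
    intro k
    simp only [a, b]
    rw [lintegral_avoids_succ G x y k h hy, ← lintegral_add_left (hma k)]
    refine lintegral_congr fun ω => ?_
    by_cases hω : ∀ i ≤ k, ω i ≠ y
    · have : avoids y k ω = 1 := if_pos hω
      rw [this, one_mul, one_mul, hstep _ (hω k le_rfl)]
    · have : avoids y k ω = 0 := if_neg hω
      simp [this]
  have hsum : ∀ K, ∑ j ∈ Finset.range K, a j + b K = h x := by
    intro K
    induction K with
    | zero => simpa using hb0
    | succ K ih => rw [Finset.sum_range_succ, add_assoc, ← hrec, ih]
  have htsum : ∑' j, a j ≤ h x := by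
    rw [ENNReal.tsum_eq_iSup_nat]
    exact iSup_le fun K => (hsum K) ▸ le_self_add
  have ha0 : Filter.Tendsto a Filter.atTop (nhds 0) :=
    ENNReal.tendsto_atTop_zero_of_tsum_ne_top (ne_top_of_le_ne_top (hfin x) htsum)
  have hbC : ∀ k, b k ≤ a k * ∑ z, h z := by
    intro k
    simp only [a, b]
    rw [← lintegral_mul_const _ (hma k)]
    refine lintegral_mono fun ω => ?_
    gcongr
    exact Finset.single_le_sum (f := h) (fun _ _ => zero_le) (Finset.mem_univ _)
  have hC : ∑ z, h z ≠ ⊤ := by simp [hfin]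
  have hb : Filter.Tendsto b Filter.atTop (nhds 0) := by
    have : Filter.Tendsto (fun k => a k * ∑ z, h z) Filter.atTop (nhds 0) := by
      simpa using ENNReal.Tendsto.mul_const ha0 (Or.inr hC)
    exact tendsto_of_tendsto_of_tendsto_of_le_of_le tendsto_const_nhds this (fun _ => zero_le) hbC
  have hlim : Filter.Tendsto (fun K => ∑ j ∈ Finset.range K, a j + b K) Filter.atTop
      (nhds (∑' j, a j + 0)) := (ENNReal.tendsto_nat_tsum a).add hb
  simp_rw [hsum, add_zero] at hlim
  rw [tendsto_nhds_unique tendsto_const_nhds hlim]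
  simp_rw [firstHit_eq_tsum_avoids]
  exact lintegral_tsum fun k => (hma k).aemeasurable

end RandomWalk

/-- A finite solution of the Poisson equation with pole `y` computes the hitting times of `y`. -/
theorem hittingTime_eq {V : Type u} [Fintype V] (G : SimpleGraph V) (y : V) (h : V → ℝ≥0∞)
    (hfin : ∀ x, h x ≠ ⊤) (hy : h y = 0)
    (hstep : ∀ x, x ≠ y → h x = 1 + ∑ z, h z * stepLaw G x z) (x : V) :
    hittingTime G x y = h x := by
  let _ : MeasurableSpace V := ⊤
  have : DiscreteMeasurableSpace V := ⟨fun _ => trivial⟩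
  exact lintegral_firstHit G y h hfin hy hstep x

open Classical in
/-- Real-valued version of the Poisson equation, summed over the neighbours. -/
theorem hittingTime_eq_ofReal {V : Type u} [Fintype V] (G : SimpleGraph V) (y : V) (h : V → ℝ)
    (hnn : ∀ x, 0 ≤ h x) (hy : h y = 0) (hne : ∀ x, x ≠ y → ∃ z, G.Adj x z)
    (hstep : ∀ x, x ≠ y → ∑ z ∈ G.neighborFinset x, (h z - h x) = -(G.degree x : ℝ)) (x : V) :
    hittingTime G x y = ENNReal.ofReal (h x) := by
  refine hittingTime_eq G y (fun x => ENNReal.ofReal (h x)) (fun _ => ENNReal.ofReal_ne_top)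
    (by simp [hy]) (fun x hx => ?_) x
  obtain ⟨w, hw⟩ := hne x hx
  have hN : (G.neighborFinset x).Nonempty := ⟨w, by simpa using hw⟩
  have hd : 0 < (G.degree x : ℝ) := by
    rw [← G.card_neighborFinset_eq_degree]; exact_mod_cast hN.card_pos
  have e : ∀ z, ENNReal.ofReal (h z) * stepLaw G x z =
      ENNReal.ofReal (if z ∈ G.neighborFinset x then h z * (G.degree x : ℝ)⁻¹ else 0) := by
    intro z
    rw [stepLaw, dif_pos hN, PMF.uniformOfFinset_apply]
    split_ifs
    · rw [ENNReal.ofReal_mul (hnn z), ENNReal.ofReal_inv_of_pos hd, ENNReal.ofReal_natCast,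
        G.card_neighborFinset_eq_degree]
    · simp
  simp_rw [e]
  rw [← ENNReal.ofReal_sum_of_nonneg, ← ENNReal.ofReal_one, ← ENNReal.ofReal_add zero_le_one]
  · congr 1
    rw [← Finset.sum_filter, Finset.filter_mem_eq_inter, Finset.univ_inter, ← Finset.sum_mul]
    have := hstep x hx
    rw [Finset.sum_sub_distrib, Finset.sum_const, G.card_neighborFinset_eq_degree,
      nsmul_eq_mul] at this
    field_simp
    linarith
  · exact Finset.sum_nonneg fun z _ => by
      split_ifs
      · have := hnn z; positivity
      · exact le_rfl
  · intro z _
    split_ifs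
    · have := hnn z; positivity
    · exact le_rfl

/-! ### Distances in trees -/

section Tree

variable {V : Type u} {G : SimpleGraph V}

theorem exists_adj_dist_add_one (hG : G.Connected) {x z : V} (hxz : x ≠ z) :
    ∃ p, G.Adj x p ∧ G.dist p z + 1 = G.dist x z := by
  obtain ⟨w, hw⟩ := hG.exists_walk_length_eq_dist x z
  cases w with
  | nil => exact absurd rfl hxz
  | @cons _ p _ h w =>
    refine ⟨p, h, ?_⟩
    have h1 := G.dist_le w
    have h2 := hG.dist_triangle (u := x) (v := p) (w := z)
    rw [SimpleGraph.dist_eq_one_iff_adj.2 h] at h2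
    rw [SimpleGraph.Walk.length_cons] at hw
    omega

/-- Geodesics through `p` and through `q` are both paths from `x` to `z`; a tree has only one, so
their second vertices agree. -/
theorem eq_of_adj_of_dist_add_one (hG : G.IsTree) {x z p q : V} (hp : G.Adj x p) (hq : G.Adj x q)
    (hpz : G.dist p z + 1 = G.dist x z) (hqz : G.dist q z + 1 = G.dist x z) : p = q := by
  obtain ⟨P, hP⟩ := hG.connected.exists_walk_length_eq_dist p z
  obtain ⟨Q, hQ⟩ := hG.connected.exists_walk_length_eq_dist q z
  have hP' : (SimpleGraph.Walk.cons hp P).IsPath :=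
    SimpleGraph.Walk.isPath_of_length_eq_dist _ (by rw [SimpleGraph.Walk.length_cons]; omega)
  have hQ' : (SimpleGraph.Walk.cons hq Q).IsPath :=
    SimpleGraph.Walk.isPath_of_length_eq_dist _ (by rw [SimpleGraph.Walk.length_cons]; omega)
  have := congrArg (fun R : G.Path x z => R.1.snd) 
    ((hG.isAcyclic.subsingleton_path x z).elim ⟨_, hP'⟩ ⟨_, hQ'⟩)
  simpa using this

theorem sq_dist_sub_dist_of_adj (hG : G.IsTree) (z : V) {x x' : V} (h : G.Adj x x') :
    ((G.dist x' z : ℝ) - G.dist x z) ^ 2 = 1 := by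
  have h1 := hG.dist_eq_dist_add_one_of_adj z h
  rw [G.dist_comm (u := z), G.dist_comm (u := z)] at h1
  rcases h1 with h1 | h1 <;> rw [h1] <;> push_cast <;> ring

/-- If the edge `ab` points away from `c` but towards its neighbour `d`, then `cd` is `ab`. -/
theorem eq_of_dist_of_dist (hG : G.IsTree) {a b c d : V} (hab : G.Adj a b) (hcd : G.Adj c d)
    (h1 : G.dist c b = G.dist c a + 1) (h2 : G.dist d a = G.dist d b + 1) : c = a ∧ d = b := by
  have hb := hG.dist_eq_dist_add_one_of_adj b hcd
  have ha := hG.dist_eq_dist_add_one_of_adj a hcd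
  rw [G.dist_comm (u := b), G.dist_comm (u := b)] at hb
  rw [G.dist_comm (u := a), G.dist_comm (u := a)] at ha
  have hx : G.dist c a = G.dist d b := by omega
  have hca : c = a := by
    -- The neighbour `p` of `c` towards `a` is also closer to `b`, as is `d`; uniqueness forces `p =
    -- d`, yet `d` is farther from `a` than `c` is.
    by_contra hne
    obtain ⟨p, hp, hpa⟩ := exists_adj_dist_add_one hG.connected hne
    have hpb := hG.dist_eq_dist_add_one_of_adj b hp
    rw [G.dist_comm (u := b), G.dist_comm (u := b)] at hpb
    have t1 := hG.connected.dist_triangle (u := p) (v := a) (w := b)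
    rw [SimpleGraph.dist_eq_one_iff_adj.2 hab] at t1
    have : p = d := eq_of_adj_of_dist_add_one hG hp hcd (z := b) (by omega) (by omega)
    subst this
    omega
  refine ⟨hca, ?_⟩
  subst hca
  rw [G.dist_self] at hx
  exact (hG.connected.dist_eq_zero_iff).1 hx.symm

end Tree

/-! ### Distance sums, hitting times and the mean hitting time in a finite tree. -/

section FiniteTree

open Classical

variable {V : Type u} [Fintype V] {G : SimpleGraph V}

/-- For `x ≠ z` exactly one neighbour is closer to `z` and contributes `-1`; every other one
contributes `+1`. -/
theorem sum_dist_sub_dist (hG : G.IsTree) (x z : V) :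
    ∑ x' ∈ G.neighborFinset x, ((G.dist x' z : ℝ) - G.dist x z) =
      G.degree x - 2 * (if x = z then 0 else 1) := by
  by_cases hxz : x = z
  · subst hxz
    rw [Finset.sum_congr rfl (g := fun _ => (1 : ℝ))]
    · simp
    · intro x' hx'
      rw [SimpleGraph.mem_neighborFinset] at hx'
      rw [SimpleGraph.dist_eq_one_iff_adj.2 hx'.symm]
      simp
  · obtain ⟨p, hp, hpz⟩ := exists_adj_dist_add_one hG.connected hxz
    rw [Finset.sum_congr rfl (g := fun x' => (1 : ℝ) - 2 * if x' = p then 1 else 0)]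
    · rw [Finset.sum_sub_distrib, ← Finset.mul_sum, Finset.sum_ite_eq']
      simp [hp, hxz]
    · intro x' hx'
      rw [SimpleGraph.mem_neighborFinset] at hx'
      split_ifs with h
      · subst h
        rw [← hpz]; push_cast; ring
      · have h1 := hG.dist_eq_dist_add_one_of_adj z hx'
        rw [G.dist_comm (u := z), G.dist_comm (u := z)] at h1
        rcases h1 with h1 | h1
        · exact absurd (eq_of_adj_of_dist_add_one hG hx' hp h1.symm hpz) h
        · rw [h1]; push_cast; ring

theorem sum_sum_neighborFinset_comm (G : SimpleGraph V) (g : V → V → ℝ) :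
    ∑ x, ∑ x' ∈ G.neighborFinset x, g x x' = ∑ x, ∑ x' ∈ G.neighborFinset x, g x' x := by
  rw [Finset.sum_comm']
  intro x y
  simp [G.adj_comm]

theorem card_edgeSet_eq (hG : G.IsTree) :
    (Fintype.card G.edgeSet : ℝ) = (Fintype.card V : ℝ) - 1 := by
  have := hG.card_edgeFinset
  rw [SimpleGraph.edgeFinset_card] at this
  rw [← this]; push_cast; ring

theorem sum_degree (hG : G.IsTree) :
    ∑ x, (G.degree x : ℝ) = 2 * ((Fintype.card V : ℝ) - 1) := by
  rw [← card_edgeSet_eq hG, ← SimpleGraph.edgeFinset_card]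
  exact_mod_cast G.sum_degrees_eq_twice_card_edges

/-- The differences of squared distances over oriented edges cancel in pairs. Since `d' - d = ±1`,
each equals `2d(d' - d) + 1`, and summing over neighbours with `sum_dist_sub_dist` yields the
identity. -/
theorem sum_degree_mul_dist (hG : G.IsTree) (z : V) :
    ∑ x, (G.degree x : ℝ) * G.dist x z =
      2 * ∑ x, (G.dist x z : ℝ) - ((Fintype.card V : ℝ) - 1) := by
  have h0 : ∑ x, ∑ x' ∈ G.neighborFinset x, ((G.dist x' z : ℝ) ^ 2 - (G.dist x z : ℝ) ^ 2) = 0 := by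
    simp_rw [Finset.sum_sub_distrib]
    rw [sum_sum_neighborFinset_comm G (fun _ x' => (G.dist x' z : ℝ) ^ 2), sub_self]
  have h1 : ∀ x, ∑ x' ∈ G.neighborFinset x, ((G.dist x' z : ℝ) ^ 2 - (G.dist x z : ℝ) ^ 2) =
      2 * ((G.degree x : ℝ) * G.dist x z) - 4 * G.dist x z + G.degree x := by
    intro x
    have : ∀ x' ∈ G.neighborFinset x, ((G.dist x' z : ℝ) ^ 2 - (G.dist x z : ℝ) ^ 2) =
        2 * (G.dist x z : ℝ) * ((G.dist x' z : ℝ) - G.dist x z) + 1 := by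
      intro x' hx'
      rw [← sq_dist_sub_dist_of_adj hG z ((G.mem_neighborFinset _ _).1 hx')]
      ring
    rw [Finset.sum_congr rfl this, Finset.sum_add_distrib, ← Finset.mul_sum, sum_dist_sub_dist hG]
    split_ifs with h
    · simp [h]
    · simp; ring
  simp_rw [h1] at h0
  rw [Finset.sum_add_distrib, Finset.sum_sub_distrib, ← Finset.mul_sum, ← Finset.mul_sum,
    sum_degree hG] at h0
  linarith

/-- The hitting time in a tree as a combination of distances. -/
theorem hittingTime_of_isTree (hG : G.IsTree) (x y : V) :
    hittingTime G x y = ENNReal.ofReal (1 / 2 * ∑ z, (G.degree z : ℝ) *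
      ((G.dist x y : ℝ) + G.dist y z - G.dist x z)) := by
  refine hittingTime_eq_ofReal G y (fun x => 1 / 2 * ∑ z, (G.degree z : ℝ) *
      ((G.dist x y : ℝ) + G.dist y z - G.dist x z)) (fun x => ?_) ?_ (fun x hx => ?_)
      (fun x hx => ?_) x
  · refine mul_nonneg (by norm_num) (Finset.sum_nonneg fun z _ => mul_nonneg (by positivity) ?_)
    have := hG.connected.dist_triangle (u := x) (v := y) (w := z)
    rw [sub_nonneg]
    exact_mod_cast this
  · simp
  · obtain ⟨p, hp, -⟩ := exists_adj_dist_add_one hG.connected hx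
    exact ⟨p, hp⟩
  · have e : ∀ x' : V, 1 / 2 * ∑ z, (G.degree z : ℝ) * ((G.dist x' y : ℝ) + G.dist y z - G.dist x' z)
        - 1 / 2 * ∑ z, (G.degree z : ℝ) * ((G.dist x y : ℝ) + G.dist y z - G.dist x z) =
        ∑ z, 1 / 2 * (G.degree z : ℝ) * (((G.dist x' y : ℝ) - G.dist x y) -
          ((G.dist x' z : ℝ) - G.dist x z)) := by
      intro x'
      rw [← mul_sub, ← Finset.sum_sub_distrib, Finset.mul_sum]
      exact Finset.sum_congr rfl fun z _ => by ring
    simp_rw [e]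
    rw [Finset.sum_comm]
    -- For `x ≠ y` the Laplacians of the distances to `y` and to `z` cancel unless `z = x`.
    rw [Finset.sum_congr rfl (g := fun z => if x = z then -(G.degree z : ℝ) else 0)]
    · simp
    · intro z _
      rw [← Finset.mul_sum, Finset.sum_sub_distrib, sum_dist_sub_dist hG, sum_dist_sub_dist hG,
        if_neg hx]
      split_ifs <;> ring

/-- In the symmetrised formula the terms `d(y,z) - d(x,z)` cancel, leaving the total degree times
the distance. -/
theorem hittingTime_add_hittingTime (hG : G.IsTree) (x y : V) :
    hittingTime G x y ≠ ⊤ ∧ (hittingTime G x y).toReal + (hittingTime G y x).toReal =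
      2 * ((Fintype.card V : ℝ) - 1) * G.dist x y := by
  have hnn : ∀ x y : V, 0 ≤ 1 / 2 * ∑ z, (G.degree z : ℝ) *
      ((G.dist x y : ℝ) + G.dist y z - G.dist x z) := by
    intro x y
    refine mul_nonneg (by norm_num) (Finset.sum_nonneg fun z _ => mul_nonneg (by positivity) ?_)
    have := hG.connected.dist_triangle (u := x) (v := y) (w := z)
    rw [sub_nonneg]
    exact_mod_cast this
  refine ⟨by rw [hittingTime_of_isTree hG]; exact ENNReal.ofReal_ne_top, ?_⟩
  rw [hittingTime_of_isTree hG, hittingTime_of_isTree hG, ENNReal.toReal_ofReal (hnn x y),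
    ENNReal.toReal_ofReal (hnn y x), ← mul_add, ← Finset.sum_add_distrib, ← sum_degree hG,
    Finset.sum_mul, Finset.mul_sum]
  refine Finset.sum_congr rfl fun z _ => ?_
  rw [G.dist_comm (u := y) (v := x)]
  ring

theorem meanHittingTime_of_isTree (hG : G.IsTree) (hV : 2 ≤ Fintype.card V) :
    meanHittingTime G ≠ ⊤ ∧
      (meanHittingTime G).toReal = 2 / (Fintype.card V : ℝ) * wienerIndex G := by
  have hfin : ∀ x y : V, hittingTime G x y ≠ ⊤ := fun x y => (hittingTime_add_hittingTime hG x y).1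
  have hsfin : ∑ x : V, ∑ y : V, hittingTime G x y ≠ ⊤ := by simp [hfin]
  have hV' : (2 : ℝ) ≤ Fintype.card V := by exact_mod_cast hV
  have hcard : ((Fintype.card V : ℝ≥0∞) - 1) = ((Fintype.card V - 1 : ℕ) : ℝ≥0∞) := by
    rw [ENNReal.natCast_sub]; simp
  have hsum : (∑ x : V, ∑ y : V, hittingTime G x y).toReal =
      ((Fintype.card V : ℝ) - 1) * (2 * wienerIndex G) := by
    rw [ENNReal.toReal_sum (fun x _ => by simp [hfin])]
    simp_rw [ENNReal.toReal_sum (fun y _ => hfin _ y)]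
    have h1 : ∑ x : V, ∑ y : V, (hittingTime G x y).toReal =
        ∑ x : V, ∑ y : V, (hittingTime G y x).toReal := Finset.sum_comm
    have h2 : ∑ x : V, ∑ y : V, (hittingTime G x y).toReal +
        ∑ x : V, ∑ y : V, (hittingTime G y x).toReal =
        2 * ((Fintype.card V : ℝ) - 1) * ∑ x : V, ∑ y : V, (G.dist x y : ℝ) := by
      simp_rw [← Finset.sum_add_distrib, (hittingTime_add_hittingTime hG _ _).2, Finset.mul_sum]
    unfold wienerIndex
    linarith
  unfold meanHittingTime
  rw [hcard]
  constructor
  · refine ENNReal.div_ne_top hsfin ?_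
    have : Fintype.card V ≠ 0 ∧ Fintype.card V - 1 ≠ 0 := by omega
    exact_mod_cast mul_ne_zero this.1 this.2
  · rw [ENNReal.toReal_div, ENNReal.toReal_mul, hsum, ENNReal.toReal_natCast,
      ENNReal.toReal_natCast, Nat.cast_sub (by omega), Nat.cast_one]
    have h1 : (Fintype.card V : ℝ) ≠ 0 := by linarith
    have h2 : (Fintype.card V : ℝ) - 1 ≠ 0 := by linarith
    field_simp

/-- Summing over the two ends of each edge weights each vertex by its degree. -/
theorem sum_edgeSet_out (G : SimpleGraph V) (g : V → ℝ) :
    ∑ e : G.edgeSet, (g (Quot.out (e : Sym2 V)).1 + g (Quot.out (e : Sym2 V)).2) =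
      ∑ x, (G.degree x : ℝ) * g x := by
  have h1 : ∀ x, (G.degree x : ℝ) * g x = ∑ e : G.edgeSet, if x ∈ (e : Sym2 V) then g x else 0 := by
    intro x
    rw [← G.card_incidenceFinset_eq_degree, Finset.sum_ite, Finset.sum_const_zero, add_zero,
      Finset.sum_const, nsmul_eq_mul]
    congr 2
    symm
    refine Finset.card_bij (fun e _ => (e : Sym2 V)) ?_ ?_ ?_
    · rintro ⟨e, he⟩ h
      simpa [SimpleGraph.incidenceSet, he] using h
    · rintro ⟨e, he⟩ _ ⟨f, hf⟩ _ h
      exact Subtype.ext h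
    · intro e he
      rw [SimpleGraph.mem_incidenceFinset] at he
      exact ⟨⟨e, he.1⟩, by simpa using he.2, rfl⟩
  simp_rw [h1]
  rw [Finset.sum_comm]
  refine Finset.sum_congr rfl fun e _ => ?_
  have hout : (e : Sym2 V) = s((Quot.out (e : Sym2 V)).1, (Quot.out (e : Sym2 V)).2) :=
    (Quot.out_eq (e : Sym2 V)).symm
  have hne : (Quot.out (e : Sym2 V)).1 ≠ (Quot.out (e : Sym2 V)).2 := by
    have := e.2
    rw [hout, SimpleGraph.mem_edgeSet] at this
    exact this.ne
  generalize (Quot.out (e : Sym2 V)).1 = a at *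
  generalize (Quot.out (e : Sym2 V)).2 = b at *
  rw [hout, ← Finset.sum_filter]
  have : Finset.univ.filter (fun x => x ∈ s(a, b)) = {a, b} := by ext; simp
  rw [this, Finset.sum_pair hne]

end FiniteTree

/-! ### Distances in the subdivision of a tree -/

/-- A function that is `1`-Lipschitz along edges, vanishes at `z`, and decreases along some edge at
every other vertex, is the distance to `z`. -/
theorem reachable_and_dist_eq {V : Type u} {G : SimpleGraph V} (z : V) (φ : V → ℕ)
    (hz : φ z = 0) (hlip : ∀ x y, G.Adj x y → φ x ≤ φ y + 1)
    (hdesc : ∀ x, x ≠ z → ∃ y, G.Adj x y ∧ φ y + 1 = φ x) (x : V) :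
    G.Reachable x z ∧ G.dist x z = φ x := by
  have hup : ∀ k x, φ x = k → ∃ w : G.Walk x z, w.length = k := by
    intro k
    induction k with
    | zero =>
      intro x hx
      by_cases hxz : x = z
      · subst hxz; exact ⟨SimpleGraph.Walk.nil, rfl⟩
      · obtain ⟨y, -, hy⟩ := hdesc x hxz
        omega
    | succ k ih =>
      intro x hx
      have hxz : x ≠ z := by rintro rfl; omega
      obtain ⟨y, hy, hy'⟩ := hdesc x hxz
      obtain ⟨w, hw⟩ := ih y (by omega)
      exact ⟨SimpleGraph.Walk.cons hy w, by rw [SimpleGraph.Walk.length_cons, hw]⟩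
  have hlow : ∀ {x y : V} (w : G.Walk x y), φ x ≤ φ y + w.length := by
    intro x y w
    induction w with
    | nil => simp
    | cons h w ih =>
      have := hlip _ _ h
      rw [SimpleGraph.Walk.length_cons]
      omega
  obtain ⟨w, hw⟩ := hup _ x rfl
  refine ⟨w.reachable, le_antisymm (hw ▸ G.dist_le w) ?_⟩
  obtain ⟨w', hw'⟩ := w.reachable.exists_walk_length_eq_dist
  have := hlow w'
  omega

section Subdivision

variable {V : Type u} {G : SimpleGraph V} {m : ℕ}

/-- The chosen first endpoint of an edge. -/
abbrev src (e : G.edgeSet) : V := (Quot.out (e : Sym2 V)).1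

/-- The chosen second endpoint of an edge. -/
abbrev tgt (e : G.edgeSet) : V := (Quot.out (e : Sym2 V)).2

theorem mk_src_tgt (e : G.edgeSet) : s(src e, tgt e) = (e : Sym2 V) := Quot.out_eq (e : Sym2 V)

theorem adj_src_tgt (e : G.edgeSet) : G.Adj (src e) (tgt e) := by
  rw [← SimpleGraph.mem_edgeSet, mk_src_tgt]
  exact e.2

theorem edgePath_zero (e : G.edgeSet) : edgePath m G e 0 = Sum.inl (src e) := if_pos rfl

theorem edgePath_last (e : G.edgeSet) : edgePath m G e (m + 1) = Sum.inl (tgt e) := by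
  simp [edgePath]

theorem edgePath_inner (e : G.edgeSet) (i : Fin m) :
    edgePath m G e ((i : ℕ) + 1) = Sum.inr (e, i) := by
  simp [edgePath]

theorem eq_zero_or_eq_last_or_inner {k : ℕ} (hk : k ≤ m + 1) :
    (k = 0) ∨ (k = m + 1) ∨ ∃ i : Fin m, k = i + 1 := by
  rcases Nat.eq_zero_or_pos k with h | h
  · exact Or.inl h
  · rcases hk.eq_or_lt with h' | h'
    · exact Or.inr (Or.inl h')
    · exact Or.inr (Or.inr ⟨⟨k - 1, by omega⟩, by simp; omega⟩)

theorem edgePath_adj (e : G.edgeSet) {k : ℕ} (hk : k ≤ m) :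
    (subdivision m G).Adj (edgePath m G e k) (edgePath m G e (k + 1)) := by
  refine (SimpleGraph.fromEdgeSet_adj _).2 ⟨⟨e, k, hk, rfl⟩, ?_⟩
  have hne := (adj_src_tgt e).ne
  unfold edgePath
  split_ifs <;> simp_all <;> omega

theorem exists_edgePath_of_adj {p q : SubdivVertex m G} (h : (subdivision m G).Adj p q) :
    ∃ e : G.edgeSet, ∃ k ≤ m, (p = edgePath m G e k ∧ q = edgePath m G e (k + 1)) ∨
      (p = edgePath m G e (k + 1) ∧ q = edgePath m G e k) := by
  obtain ⟨⟨e, k, hk, h⟩, -⟩ := (SimpleGraph.fromEdgeSet_adj _).1 h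
  exact ⟨e, k, hk, by simpa using h⟩

/-- Distance to the old vertex `w` in the subdivision: linear interpolation of the rescaled distance
in the original tree. -/
def interp (m : ℕ) (G : SimpleGraph V) (w : V) : SubdivVertex m G → ℕ
  | Sum.inl v => (m + 1) * G.dist v w
  | Sum.inr (e, i) => (m - i) * G.dist (src e) w + (i + 1) * G.dist (tgt e) w

/-- In terms of the position `k` on the path, endpoints and inner vertices obey one affine formula;
working in `ℤ` avoids truncated subtraction. -/
theorem interp_edgePath (w : V) (e : G.edgeSet) {k : ℕ} (hk : k ≤ m + 1) :
    (interp m G w (edgePath m G e k) : ℤ) =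
      ((m : ℤ) + 1 - k) * G.dist (src e) w + k * G.dist (tgt e) w := by
  rcases eq_zero_or_eq_last_or_inner hk with rfl | rfl | ⟨i, rfl⟩
  · rw [edgePath_zero]; simp [interp]
  · rw [edgePath_last]; simp [interp]
  · rw [edgePath_inner]
    simp only [interp]
    push_cast [Nat.cast_sub i.2.le]
    ring

/-- The ends of an edge differ by one in distance to `w`, so `interp` changes by exactly one at each
step of a subdivided edge. This makes it satisfy the criterion `reachable_and_dist_eq`. -/
theorem reachable_and_dist_subdivision_inl (hG : G.IsTree) (w : V) (p : SubdivVertex m G) :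
    (subdivision m G).Reachable p (Sum.inl w) ∧
      (subdivision m G).dist p (Sum.inl w) = interp m G w p := by
  have hst : ∀ e : G.edgeSet, G.dist (src e) w = G.dist (tgt e) w + 1 ∨
      G.dist (tgt e) w = G.dist (src e) w + 1 := by
    intro e
    have := hG.dist_eq_dist_add_one_of_adj w (adj_src_tgt e)
    rwa [G.dist_comm (u := w), G.dist_comm (u := w)] at this
  have hdiff : ∀ (e : G.edgeSet) (k : ℕ), k ≤ m →
      (interp m G w (edgePath m G e (k + 1)) : ℤ) = interp m G w (edgePath m G e k) +
        (G.dist (tgt e) w - G.dist (src e) w) := by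
    intro e k hk
    rw [interp_edgePath w e (by omega), interp_edgePath w e (by omega)]
    push_cast
    ring
  refine reachable_and_dist_eq _ _ ?_ ?_ ?_ p
  · simp [interp]
  · intro p q h
    obtain ⟨e, k, hk, ⟨rfl, rfl⟩ | ⟨rfl, rfl⟩⟩ := exists_edgePath_of_adj h
    all_goals
      have h1 := hdiff e k hk
      have h2 := hst e
      omega
  · rintro (v | ⟨e, i⟩) hp
    · obtain ⟨v', hv', hd⟩ := exists_adj_dist_add_one hG.connected
        (fun h => hp (congrArg Sum.inl h) : v ≠ w)
      let e : G.edgeSet := ⟨s(v, v'), hv'⟩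
      have he : s(src e, tgt e) = s(v, v') := mk_src_tgt e
      -- The arbitrary orientation of `e` decides whether `v` sits at position `0` or `m + 1`.
      rcases (Sym2.eq_iff).1 he with ⟨h1, h2⟩ | ⟨h1, h2⟩
      · refine ⟨edgePath m G e 1, ?_, ?_⟩
        · rw [← h1, ← edgePath_zero]
          exact edgePath_adj e (Nat.zero_le _)
        · have h3 := hdiff e 0 (Nat.zero_le _)
          rw [edgePath_zero, zero_add, h1, h2] at h3
          omega
      · refine ⟨edgePath m G e m, ?_, ?_⟩
        · rw [← h2, ← edgePath_last]
          exact (edgePath_adj e le_rfl).symm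
        · have h3 := hdiff e m le_rfl
          rw [edgePath_last, h1, h2] at h3
          omega
    · have h1 := hdiff e i (by omega)
      have h2 := hdiff e (i + 1) (by omega)
      rw [edgePath_inner] at h1 h2
      rcases hst e with h | h
      · refine ⟨edgePath m G e (i + 1 + 1), ?_, by omega⟩
        rw [← edgePath_inner]
        exact edgePath_adj e (by omega)
      · refine ⟨edgePath m G e i, ?_, by omega⟩
        rw [← edgePath_inner]
        exact (edgePath_adj e (by omega)).symm

theorem connected_subdivision (hG : G.IsTree) : (subdivision m G).Connected := by
  obtain ⟨w⟩ := hG.connected.nonempty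
  have h := fun p => (reachable_and_dist_subdivision_inl (m := m) hG w p).1
  have : Nonempty (SubdivVertex m G) := ⟨Sum.inl w⟩
  exact ⟨fun p q => (h p).trans (h q).symm⟩

theorem card_subdivVertex [Finite V] (hG : G.IsTree) :
    Nat.card (SubdivVertex m G) = Nat.card G.edgeSet * (m + 1) + 1 := by
  have h := (SimpleGraph.isTree_iff_connected_and_card.1 hG).2
  rw [Nat.card_sum, Nat.card_prod, Nat.card_fin, ← h]
  ring

/-- By connectedness it suffices to bound the edges above: they are the image of pairs (old edge,
one of `m + 1` positions). -/
theorem isTree_subdivision [Finite V] (hG : G.IsTree) : (subdivision m G).IsTree := by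
  rw [SimpleGraph.isTree_iff_connected_and_card]
  refine ⟨connected_subdivision hG, le_antisymm ?_
    (connected_subdivision hG).card_vert_le_card_edgeSet_add_one⟩
  rw [card_subdivVertex hG]
  have hle : Nat.card (subdivision m G).edgeSet ≤ Nat.card (G.edgeSet × Fin (m + 1)) := by
    refine Nat.card_le_card_of_surjective (fun x => ⟨s(edgePath m G x.1 x.2,
      edgePath m G x.1 (x.2 + 1)), edgePath_adj x.1 (by omega)⟩) ?_
    rintro ⟨s, hs⟩
    induction s using Sym2.ind with
    | _ p q =>
      obtain ⟨e, k, hk, h⟩ := exists_edgePath_of_adj hs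
      exact ⟨(e, ⟨k, by omega⟩), Subtype.ext (Sym2.eq_iff.2 (by
        rcases h with ⟨h1, h2⟩ | ⟨h1, h2⟩
        · exact Or.inl ⟨h1.symm, h2.symm⟩
        · exact Or.inr ⟨h2.symm, h1.symm⟩))⟩
  rw [Nat.card_prod, Nat.card_fin] at hle
  omega

theorem dist_edgePath_le (hG : G.IsTree) (e : G.edgeSet) {j k : ℕ} (hjk : j ≤ k)
    (hk : k ≤ m + 1) :
    (subdivision m G).dist (edgePath m G e j) (edgePath m G e k) ≤ k - j := by
  induction k, hjk using Nat.le_induction with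
  | base => simp
  | succ k hjk ih =>
    have h1 := ih (by omega)
    have h2 := (connected_subdivision (m := m) hG).dist_triangle (u := edgePath m G e j)
      (v := edgePath m G e k) (w := edgePath m G e (k + 1))
    rw [SimpleGraph.dist_eq_one_iff_adj.2 (edgePath_adj e (by omega : k ≤ m))] at h2
    omega

theorem dist_edgePath_inl (hG : G.IsTree) (w : V) (e : G.edgeSet) {k : ℕ} (hk : k ≤ m + 1) :
    ((subdivision m G).dist (edgePath m G e k) (Sum.inl w) : ℤ) =
      ((m : ℤ) + 1 - k) * G.dist (src e) w + k * G.dist (tgt e) w := by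
  rw [(reachable_and_dist_subdivision_inl hG w _).2, interp_edgePath w e hk]

/-- The path itself gives the upper bound; the lower bound compares the distances `j` and `k` to the
first endpoint. -/
theorem dist_edgePath_same (hG : G.IsTree) (e : G.edgeSet) {j k : ℕ} (hj : j ≤ m + 1)
    (hk : k ≤ m + 1) :
    ((subdivision m G).dist (edgePath m G e j) (edgePath m G e k) : ℤ) = |(j : ℤ) - k| := by
  have h1 := dist_edgePath_inl hG (src e) e hj
  have h2 := dist_edgePath_inl hG (src e) e hk
  rw [SimpleGraph.dist_self, SimpleGraph.dist_eq_one_iff_adj.2 (adj_src_tgt e).symm] at h1 h2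
  have h3 := (connected_subdivision (m := m) hG).dist_triangle (u := edgePath m G e j)
      (v := edgePath m G e k) (w := Sum.inl (src e))
  have h4 := (connected_subdivision (m := m) hG).dist_triangle (u := edgePath m G e k)
      (v := edgePath m G e j) (w := Sum.inl (src e))
  rw [SimpleGraph.dist_comm (u := edgePath m G e k) (v := edgePath m G e j)] at h4
  rcases le_total j k with h | h
  · have h5 := dist_edgePath_le hG e h hk
    rw [abs_of_nonpos (by omega)]
    omega
  · have h5 := dist_edgePath_le hG e h hj
    rw [SimpleGraph.dist_comm] at h5
    rw [abs_of_nonneg (by omega)]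
    omega

/-- A different edge `e` lies entirely on one side of `f`, so both its ends see the same end of `f`
as the nearer one. -/
theorem dist_sub_dist_eq_of_ne (hG : G.IsTree) {e f : G.edgeSet} (hef : e ≠ f) :
    (G.dist (src e) (tgt f) : ℤ) - G.dist (src e) (src f) =
      G.dist (tgt e) (tgt f) - G.dist (tgt e) (src f) := by
  have h1 := hG.dist_eq_dist_add_one_of_adj (src e) (adj_src_tgt f)
  have h2 := hG.dist_eq_dist_add_one_of_adj (tgt e) (adj_src_tgt f)
  rcases h1 with h1 | h1 <;> rcases h2 with h2 | h2
  · omega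
  · exfalso
    have := eq_of_dist_of_dist hG (adj_src_tgt f).symm (adj_src_tgt e) h1 h2
    refine hef (Subtype.ext ?_)
    rw [← mk_src_tgt, ← mk_src_tgt f, this.1, this.2, Sym2.eq_swap]
  · exfalso
    have := eq_of_dist_of_dist hG (adj_src_tgt f) (adj_src_tgt e) h1 h2
    refine hef (Subtype.ext ?_)
    rw [← mk_src_tgt, ← mk_src_tgt f, this.1, this.2]
  · omega

/-- The distances from a point of `e` to the two ends of `f` differ by `m + 1`, the length of the
path replacing `f`. The triangle inequalities through the two ends thus pin down the distance at
position `k`. The factor `m + 1` clears the denominator of the bilinear interpolation. -/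
theorem dist_edgePath_of_ne (hG : G.IsTree) {e f : G.edgeSet} (hef : e ≠ f) {j k : ℕ}
    (hj : j ≤ m + 1) (hk : k ≤ m + 1) :
    ((m : ℤ) + 1) * (subdivision m G).dist (edgePath m G e j) (edgePath m G f k) =
      ((m : ℤ) + 1 - k) * (((m : ℤ) + 1 - j) * G.dist (src e) (src f) +
        j * G.dist (tgt e) (src f)) +
      k * (((m : ℤ) + 1 - j) * G.dist (src e) (tgt f) + j * G.dist (tgt e) (tgt f)) := by
  have h0 := dist_edgePath_inl hG (src f) e hj
  have h1 := dist_edgePath_inl hG (tgt f) e hj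
  rw [← h0, ← h1]
  have hs := dist_sub_dist_eq_of_ne hG hef
  have hst := hG.dist_eq_dist_add_one_of_adj (src e) (adj_src_tgt f)
  have hd : ((subdivision m G).dist (edgePath m G e j) (Sum.inl (tgt f)) : ℤ) -
      (subdivision m G).dist (edgePath m G e j) (Sum.inl (src f)) =
      ((m : ℤ) + 1) * (G.dist (src e) (tgt f) - G.dist (src e) (src f)) := by
    rw [h0, h1]
    linear_combination (-(j : ℤ)) * hs
  have hc := connected_subdivision (m := m) hG
  have l1 := dist_edgePath_le hG f (Nat.zero_le k) hk
  have l2 := dist_edgePath_le hG f hk le_rfl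
  rw [edgePath_zero, SimpleGraph.dist_comm] at l1
  rw [edgePath_last] at l2
  have t1 := hc.dist_triangle (u := edgePath m G e j) (v := edgePath m G f k)
    (w := Sum.inl (src f))
  have t2 := hc.dist_triangle (u := edgePath m G e j) (v := edgePath m G f k)
    (w := Sum.inl (tgt f))
  have t3 := hc.dist_triangle (u := edgePath m G e j) (v := Sum.inl (src f))
    (w := edgePath m G f k)
  have t4 := hc.dist_triangle (u := edgePath m G e j) (v := Sum.inl (tgt f))
    (w := edgePath m G f k)
  rw [SimpleGraph.dist_comm (u := Sum.inl (src f)) (v := edgePath m G f k)] at t3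
  rw [SimpleGraph.dist_comm (u := Sum.inl (tgt f)) (v := edgePath m G f k)] at t4
  generalize (subdivision m G).dist (edgePath m G e j) (Sum.inl (src f)) = A at *
  generalize (subdivision m G).dist (edgePath m G e j) (Sum.inl (tgt f)) = B at *
  generalize (subdivision m G).dist (edgePath m G e j) (edgePath m G f k) = D at *
  rcases hst with hst | hst
  · have hB : (B : ℤ) = A - (m + 1) := by
      rw [hst] at hd; push_cast at hd; linear_combination hd
    have hD : (D : ℤ) = A - k := by omega
    rw [hD, hB]; ring
  · have hB : (B : ℤ) = A + (m + 1) := by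
      rw [hst] at hd; push_cast at hd; linear_combination hd
    have hD : (D : ℤ) = A + k := by omega
    rw [hD, hB]; ring

end Subdivision

/-! ### The Wiener index of the subdivision of a tree -/

theorem sum_fin_succ (m : ℕ) : ∑ i : Fin m, ((i : ℝ) + 1) = m * (m + 1) / 2 := by
  induction m with
  | zero => simp
  | succ m ih => rw [Fin.sum_univ_castSucc]; simp only [Fin.val_castSucc, ih]; simp; ring

theorem sum_fin_sub (m : ℕ) : ∑ i : Fin m, ((m : ℝ) - i) = m * (m + 1) / 2 := by
  have := sum_fin_succ m
  rw [Finset.sum_add_distrib] at this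
  rw [Finset.sum_sub_distrib]
  simp at *
  linarith

theorem sum_fin_abs_sub (m : ℕ) :
    ∑ i : Fin m, ∑ j : Fin m, |(i : ℝ) - j| = m * ((m : ℝ) ^ 2 - 1) / 3 := by
  induction m with
  | zero => simp
  | succ m ih =>
    have h1 : ∑ i : Fin m, |(i : ℝ) - m| = m * (m + 1) / 2 := by
      rw [← sum_fin_sub]
      refine Finset.sum_congr rfl fun i _ => ?_
      have : (i : ℝ) ≤ m := by exact_mod_cast i.2.le
      rw [abs_of_nonpos (by linarith)]
      ring
    have h2 : ∑ i : Fin m, |(m : ℝ) - i| = m * (m + 1) / 2 := by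
      simp_rw [abs_sub_comm (m : ℝ), h1]
    rw [Fin.sum_univ_castSucc]
    simp_rw [Fin.sum_univ_castSucc]
    simp only [Fin.val_castSucc, Fin.val_last, Finset.sum_add_distrib, ih, h1, h2, sub_self,
      abs_zero]
    push_cast
    ring

section Wiener

open Classical

variable {V : Type u} {G : SimpleGraph V} {m : ℕ}

theorem sum_dist_inr_inl (hG : G.IsTree) (e : G.edgeSet) (w : V) :
    ∑ i : Fin m, ((subdivision m G).dist (Sum.inr (e, i)) (Sum.inl w) : ℝ) =
      (m : ℝ) * (m + 1) / 2 * (G.dist (src e) w + G.dist (tgt e) w) := by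
  have h : ∀ i : Fin m, ((subdivision m G).dist (Sum.inr (e, i)) (Sum.inl w) : ℝ) =
      ((m : ℝ) - i) * G.dist (src e) w + ((i : ℝ) + 1) * G.dist (tgt e) w := by
    intro i
    have := dist_edgePath_inl hG w e (k := i + 1) (m := m) (by omega)
    rw [edgePath_inner] at this
    have h' : (((subdivision m G).dist (Sum.inr (e, i)) (Sum.inl w) : ℤ) : ℝ) = _ :=
      congrArg _ this
    push_cast at h'
    rw [h']
    ring
  simp_rw [h]
  rw [Finset.sum_add_distrib, ← Finset.sum_mul, ← Finset.sum_mul, sum_fin_sub, sum_fin_succ]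
  ring

/-- For `e = f` bilinear interpolation would give `m²(m+1)/2`, whereas the true sum of `|i - j|` is
`m(m²-1)/3`; the correction term is the difference. -/
theorem sum_dist_inr_inr (hG : G.IsTree) (e f : G.edgeSet) :
    ∑ i : Fin m, ∑ j : Fin m, ((subdivision m G).dist (Sum.inr (e, i)) (Sum.inr (f, j)) : ℝ) =
      (m : ℝ) ^ 2 * (m + 1) / 4 * ((G.dist (src e) (src f) + G.dist (src e) (tgt f)) +
        (G.dist (tgt e) (src f) + G.dist (tgt e) (tgt f))) -
      if e = f then (m : ℝ) * (m + 1) * (m + 2) / 6 else 0 := by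
  by_cases hef : e = f
  · subst hef
    have h : ∀ i j : Fin m, ((subdivision m G).dist (Sum.inr (e, i)) (Sum.inr (e, j)) : ℝ) =
        |(i : ℝ) - j| := by
      intro i j
      have := dist_edgePath_same hG e (j := i + 1) (k := j + 1) (m := m) (by omega) (by omega)
      rw [edgePath_inner, edgePath_inner] at this
      have h' : (((subdivision m G).dist (Sum.inr (e, i)) (Sum.inr (e, j)) : ℤ) : ℝ) = _ :=
        congrArg _ this
      push_cast at h'
      rw [h']
      congr 1
      ring
    rw [Finset.sum_congr rfl fun i _ => Finset.sum_congr rfl fun j _ => h i j, sum_fin_abs_sub, if_pos rfl, SimpleGraph.dist_self, SimpleGraph.dist_self,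
      SimpleGraph.dist_eq_one_iff_adj.2 (adj_src_tgt e),
      SimpleGraph.dist_eq_one_iff_adj.2 (adj_src_tgt e).symm]
    push_cast
    ring
  · have hm : (m : ℝ) + 1 ≠ 0 := by positivity
    have h : ∀ i j : Fin m, ((subdivision m G).dist (Sum.inr (e, i)) (Sum.inr (f, j)) : ℝ) =
        ((m : ℝ) + 1)⁻¹ * (((m : ℝ) - j) * (((m : ℝ) - i) * G.dist (src e) (src f) +
          ((i : ℝ) + 1) * G.dist (tgt e) (src f)) +
        ((j : ℝ) + 1) * (((m : ℝ) - i) * G.dist (src e) (tgt f) +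
          ((i : ℝ) + 1) * G.dist (tgt e) (tgt f))) := by
      intro i j
      have := dist_edgePath_of_ne hG hef (j := i + 1) (k := j + 1) (m := m) (by omega) (by omega)
      rw [edgePath_inner, edgePath_inner] at this
      have h' := congrArg (fun z : ℤ => (z : ℝ)) this
      push_cast at h'
      rw [eq_inv_mul_iff_mul_eq₀ hm, h']
      ring
    have hj : ∀ i : Fin m,
        ∑ j : Fin m, ((subdivision m G).dist (Sum.inr (e, i)) (Sum.inr (f, j)) : ℝ) =
        (m : ℝ) / 2 * (((m : ℝ) - i) * (G.dist (src e) (src f) + G.dist (src e) (tgt f)) +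
          ((i : ℝ) + 1) * (G.dist (tgt e) (src f) + G.dist (tgt e) (tgt f))) := by
      intro i
      rw [Finset.sum_congr rfl fun j _ => h i j, ← Finset.mul_sum, Finset.sum_add_distrib,
        ← Finset.sum_mul, ← Finset.sum_mul, sum_fin_sub, sum_fin_succ]
      field_simp
      ring
    rw [Finset.sum_congr rfl fun i _ => hj i, ← Finset.mul_sum, Finset.sum_add_distrib,
      ← Finset.sum_mul, ← Finset.sum_mul, sum_fin_sub, sum_fin_succ, if_neg hef]
    ring

variable [Fintype V]

theorem sum_edgeSet_dist (hG : G.IsTree) (w : V) :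
    ∑ e : G.edgeSet, ((G.dist (src e) w : ℝ) + G.dist (tgt e) w) =
      2 * ∑ x, (G.dist x w : ℝ) - ((Fintype.card V : ℝ) - 1) := by
  rw [← sum_degree_mul_dist hG, ← sum_edgeSet_out G (fun x => (G.dist x w : ℝ))]

theorem sum_sum_edgeSet_dist (hG : G.IsTree) :
    ∑ w, ∑ e : G.edgeSet, ((G.dist (src e) w : ℝ) + G.dist (tgt e) w) =
      4 * wienerIndex G - (Fintype.card V : ℝ) * ((Fintype.card V : ℝ) - 1) := by
  simp_rw [sum_edgeSet_dist hG]
  rw [Finset.sum_sub_distrib, ← Finset.mul_sum, Finset.sum_comm, wienerIndex]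
  simp
  ring

/-- Summing over the ends of `f` and then of `e` produces degree weights, each removed by
`sum_degree_mul_dist`. -/
theorem sum_edgeSet_edgeSet_dist (hG : G.IsTree) :
    ∑ e : G.edgeSet, ∑ f : G.edgeSet,
      (((G.dist (src e) (src f) : ℝ) + G.dist (src e) (tgt f)) +
        (G.dist (tgt e) (src f) + G.dist (tgt e) (tgt f))) =
      8 * wienerIndex G -
        2 * ((Fintype.card V : ℝ) - 1) * (2 * (Fintype.card V : ℝ) - 1) := by
  have h1 : ∀ x : V, ∑ f : G.edgeSet, ((G.dist x (src f) : ℝ) + G.dist x (tgt f)) =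
      2 * ∑ y, (G.dist y x : ℝ) - ((Fintype.card V : ℝ) - 1) := by
    intro x
    rw [← sum_edgeSet_dist hG]
    simp_rw [G.dist_comm (u := x)]
  simp_rw [Finset.sum_add_distrib (f := fun f : G.edgeSet => _ + _)]
  simp_rw [h1]
  rw [sum_edgeSet_out G (fun x => 2 * ∑ y, (G.dist y x : ℝ) - ((Fintype.card V : ℝ) - 1))]
  have h2 : ∑ x, (G.degree x : ℝ) * ∑ y, (G.dist y x : ℝ) =
      4 * wienerIndex G - (Fintype.card V : ℝ) * ((Fintype.card V : ℝ) - 1) := by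
    rw [← sum_sum_edgeSet_dist hG]
    simp_rw [sum_edgeSet_dist hG, ← sum_degree_mul_dist hG, Finset.mul_sum]
    rw [Finset.sum_comm]
    simp_rw [G.dist_comm]
  have h3 : ∀ x, (G.degree x : ℝ) * (2 * ∑ y, (G.dist y x : ℝ) - ((Fintype.card V : ℝ) - 1)) =
      2 * ((G.degree x : ℝ) * ∑ y, (G.dist y x : ℝ)) -
        (G.degree x : ℝ) * ((Fintype.card V : ℝ) - 1) := fun x => by ring
  simp_rw [h3]
  rw [Finset.sum_sub_distrib, ← Finset.mul_sum, h2, ← Finset.sum_mul, sum_degree hG]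
  ring

theorem wienerIndex_subdivision (hG : G.IsTree) [inst : Fintype (SubdivVertex m G)] :
    wienerIndex (subdivision m G) = f₁ m * wienerIndex G - g₁ m * (Fintype.card V : ℝ) ^ 2 +
      h₁ m * (Fintype.card V : ℝ) - l₁ m := by
  -- The instance is left arbitrary because `Vert` carries one from `Fintype.ofFinite`, not the sum
  -- instance.
  obtain rfl : inst = instFintypeSum _ _ := Subsingleton.elim _ _
  have hll : ∀ v w : V, ((subdivision m G).dist (Sum.inl v) (Sum.inl w) : ℝ) =
      ((m : ℝ) + 1) * G.dist v w := by
    intro v w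
    rw [(reachable_and_dist_subdivision_inl hG w _).2, interp]
    push_cast
    ring
  have hlr : ∑ w : V, ∑ e : G.edgeSet, ∑ i : Fin m,
      ((subdivision m G).dist (Sum.inl w) (Sum.inr (e, i)) : ℝ) =
      (m : ℝ) * (m + 1) / 2 * (4 * wienerIndex G -
        (Fintype.card V : ℝ) * ((Fintype.card V : ℝ) - 1)) := by
    simp_rw [(subdivision m G).dist_comm (u := Sum.inl _), sum_dist_inr_inl hG, ← Finset.mul_sum,
      sum_sum_edgeSet_dist hG]
  have hrl : ∑ e : G.edgeSet, ∑ i : Fin m, ∑ w : V,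
      ((subdivision m G).dist (Sum.inr (e, i)) (Sum.inl w) : ℝ) =
      (m : ℝ) * (m + 1) / 2 * (4 * wienerIndex G -
        (Fintype.card V : ℝ) * ((Fintype.card V : ℝ) - 1)) := by
    rw [← hlr, Finset.sum_comm (s := (Finset.univ : Finset V))]
    refine Finset.sum_congr rfl fun e _ => ?_
    rw [Finset.sum_comm]
    simp_rw [(subdivision m G).dist_comm (v := Sum.inl _)]
  have hrr : ∑ e : G.edgeSet, ∑ i : Fin m, ∑ f : G.edgeSet, ∑ j : Fin m,
      ((subdivision m G).dist (Sum.inr (e, i)) (Sum.inr (f, j)) : ℝ) =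
      (m : ℝ) ^ 2 * (m + 1) / 4 * (8 * wienerIndex G -
        2 * ((Fintype.card V : ℝ) - 1) * (2 * (Fintype.card V : ℝ) - 1)) -
      ((Fintype.card V : ℝ) - 1) * ((m : ℝ) * (m + 1) * (m + 2) / 6) := by
    have : ∀ e : G.edgeSet, ∑ i : Fin m, ∑ f : G.edgeSet, ∑ j : Fin m,
        ((subdivision m G).dist (Sum.inr (e, i)) (Sum.inr (f, j)) : ℝ) =
        ∑ f : G.edgeSet, ∑ i : Fin m, ∑ j : Fin m,
        ((subdivision m G).dist (Sum.inr (e, i)) (Sum.inr (f, j)) : ℝ) :=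
      fun e => Finset.sum_comm
    simp_rw [this, sum_dist_inr_inr hG, Finset.sum_sub_distrib, ← Finset.mul_sum,
      sum_edgeSet_edgeSet_dist hG, Finset.sum_ite_eq, Finset.mem_univ, if_true, Finset.sum_const,
      Finset.card_univ, nsmul_eq_mul, card_edgeSet_eq hG]
  have hW : ∑ v : V, ∑ w : V, (G.dist v w : ℝ) = 2 * wienerIndex G := by
    unfold wienerIndex; ring
  rw [wienerIndex]
  simp_rw [Fintype.sum_sum_type, Fintype.sum_prod_type, Finset.sum_add_distrib, hll,
    ← Finset.mul_sum]
  rw [hlr, hrl, hrr, hW]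
  unfold f₁ g₁ h₁ l₁
  ring

end Wiener

/-! ### Iterated subdivision -/

variable {V : Type u} [Fintype V]

theorem isTree_graph {T : SimpleGraph V} (hT : T.IsTree) (m t : ℕ) : (graph m T t).IsTree := by
  induction t with
  | zero => exact hT
  | succ t ih =>
    have := finite_vert m T t
    exact isTree_subdivision ih

theorem card_vert {T : SimpleGraph V} (hT : T.IsTree) (m t : ℕ) :
    (Fintype.card (Vert m T t) : ℝ) = ((Fintype.card V : ℝ) - 1) * ((m : ℝ) + 1) ^ t + 1 := by
  induction t with
  | zero =>
    have : Fintype.card (Vert m T 0) = Fintype.card V := Fintype.card_congr (Equiv.refl V)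
    rw [this]; ring
  | succ t ih =>
    have h1 := card_subdivVertex (m := m) (isTree_graph hT m t)
    have h2 := (SimpleGraph.isTree_iff_connected_and_card.1 (isTree_graph hT m t)).2
    rw [Nat.card_eq_fintype_card (α := Vert m T t)] at h2
    have h3 : Fintype.card (Vert m T (t + 1)) = Nat.card (graph m T t).edgeSet * (m + 1) + 1 := by
      rw [← h1, ← Nat.card_eq_fintype_card]; rfl
    rw [h3]
    rw [← h2] at ih
    push_cast at ih ⊢
    rw [pow_succ]
    linear_combination ((m : ℝ) + 1) * ih

theorem wienerIndex_graph {T : SimpleGraph V} (hT : T.IsTree) (m t : ℕ) :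
    wienerIndex (graph m T t) = f₁ m ^ t * wienerIndex T
      - g₁ m * ∑ i ∈ Finset.range t, f₁ m ^ i * (Fintype.card (Vert m T (t - 1 - i)) : ℝ) ^ 2
      + h₁ m * ∑ i ∈ Finset.range t, f₁ m ^ i * (Fintype.card (Vert m T (t - 1 - i)) : ℝ)
      - l₁ m * ∑ i ∈ Finset.range t, f₁ m ^ i := by
  induction t with
  | zero =>
    have h : ∀ i j : Fintype V, @wienerIndex V i T = @wienerIndex V j T := fun i j => by
      rw [Subsingleton.elim i j]
    have : wienerIndex (graph m T 0) = wienerIndex T := h _ _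
    simp [this]
  | succ t ih =>
    have key : wienerIndex (graph m T (t + 1)) = f₁ m * wienerIndex (graph m T t) -
        g₁ m * (Fintype.card (Vert m T t) : ℝ) ^ 2 + h₁ m * (Fintype.card (Vert m T t) : ℝ) -
        l₁ m :=
      wienerIndex_subdivision (m := m) (isTree_graph hT m t)
        (inst := (inferInstance : Fintype (Vert m T (t + 1))))
    have hidx : ∀ i, t + 1 - 1 - (i + 1) = t - 1 - i := fun i => by omega
    -- The newest subdivision contributes the term `i = 0`; multiplication by `f₁` shifts all older
    -- terms by one index.
    rw [key, ih, Finset.sum_range_succ', Finset.sum_range_succ', Finset.sum_range_succ']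
    simp_rw [hidx, pow_succ', mul_assoc, ← Finset.mul_sum]
    simp only [add_tsub_cancel_right, tsub_zero, pow_zero, one_mul]
    ring

end SubdivisionTree

end

theorem propositionI7 {V : Type*} [Fintype V] (T : SimpleGraph V) (hT : T.IsTree)
    (n : ℕ) (hn : Fintype.card V = n) (m t : ℕ) :
    (Fintype.card (SubdivisionTree.Vert m T t) : ℝ) = ((n : ℝ) - 1) * ((m : ℝ) + 1) ^ t + 1 ∧
    (2 ≤ n →
      SubdivisionTree.meanHittingTime (SubdivisionTree.graph m T t) ≠ ⊤ ∧
      (SubdivisionTree.meanHittingTime (SubdivisionTree.graph m T t)).toReal =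
        2 / (Fintype.card (SubdivisionTree.Vert m T t) : ℝ) *
          (SubdivisionTree.f₁ m ^ t * SubdivisionTree.wienerIndex T
            - SubdivisionTree.g₁ m * ∑ i ∈ Finset.range t, SubdivisionTree.f₁ m ^ i *
                (Fintype.card (SubdivisionTree.Vert m T (t - 1 - i)) : ℝ) ^ 2
            + SubdivisionTree.h₁ m * ∑ i ∈ Finset.range t, SubdivisionTree.f₁ m ^ i *
                (Fintype.card (SubdivisionTree.Vert m T (t - 1 - i)) : ℝ)
            - SubdivisionTree.l₁ m * ∑ i ∈ Finset.range t, SubdivisionTree.f₁ m ^ i)) := by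
  subst hn
  have hcard := SubdivisionTree.card_vert hT m t
  refine ⟨hcard, fun hn => ?_⟩
  have h2 : 2 ≤ Fintype.card (SubdivisionTree.Vert m T t) := by
    have h1 : (1 : ℝ) ≤ ((m : ℝ) + 1) ^ t := one_le_pow₀ (by linarith [Nat.cast_nonneg (α := ℝ) m])
    have hn' : (2 : ℝ) ≤ Fintype.card V := by exact_mod_cast hn
    have : (2 : ℝ) ≤ Fintype.card (SubdivisionTree.Vert m T t) := by
      rw [hcard]; nlinarith
    exact_mod_cast this
  rw [← SubdivisionTree.wienerIndex_graph hT m t]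
  exact SubdivisionTree.meanHittingTime_of_isTree (SubdivisionTree.isTree_graph hT m t) h2
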